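/- **Conventions.** For integers $n_1,\dots,n_k$ let $C[n_1,\dots,n_k]$ be the Conway diagram read from top to bottom: two bridges at the top join positions $1,2$ and $3,4$; the $j$-th block consists of $|n_j|$ crossings between positions $2,3$ if $j$ is odd and between positions $1,2$ if $j$ is even; at the bottom two bridges join positions $1,2$ and $3,4$ if $k$ is odd, and positions $1,4$ and $2,3$ if $k$ is even. Put $\epsilon=\operatorname{sign}(n_j)$ for $j$ odd and $\epsilon=-\operatorname{sign}(n_j)$ for $j$ even; at each crossing of block $j$ the strand coming from the upper right passes over if $\epsilon=1$, and the one coming from the upper left if $\epsilon=-1$. Fix an orientation of the diagram. Let $\langle x,y\rangle=x_1y_2-x_2y_1$, colour the two top bridges by $a=(1,0)^T$ and $b=(0,u)^T$, so $\langle a,b\rangle=u$, and descend: if the arcs entering a crossing from the left and right have vectors $x,y\in\mathbb Z[u]^2$, the arcs leaving it have vectors $y,\ -(x+\delta\langle x,y\rangle y)$ if $\epsilon=1$, and $-(y-\delta\langle y,x\rangle x),\ x$ if $\epsilon=-1$, where $\delta=1$ if the over-strand is directed downward and $\delta=-1$ if upward. Let $u_j\in\mathbb Z[u]$ be the determinant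 $\langle x,y\rangle$ of the two vectors entering block $j$ from the left and right (so $u_1=u$); $(u_1,\dots,u_k)$ is the $u_i$-sequence. If $x$ is the final vector at position $3$ ($k$ odd) or at position $1$ ($k$ even), the rep-polynomial of the diagram is $\pm\langle x,b\rangle\in\mathbb Z[u]$, with the sign for which the leading coefficient is positive (it is $0$ if $\langle x,b\rangle=0$). For $\mathbf a=(a_1,\dots,a_m)$ put $\mathbf a^{-1}=(a_m,\dots,a_1)$. An ORS-expansion (Ohtsuki–Riley–Sakuma expansion) of type $n\ge1$ with respect to $\mathbf a$ is a diagram $$K=C[\epsilon_1\mathbf a,2c_1,\epsilon_2\mathbf a^{-1},2c_2,\epsilon_3\mathbf a,2c_3,\dots,2c_{n-1},\epsilon_n\mathbf a^{(-1)^{n+1}}],\qquad \epsilon_i=\pm1,\ \epsilon_1=1,\ c_i\in\mathbb Z.$$ **Theorem 7.2.** Let $K$ be a diagram that is an ORS-expansion of type $n$ with respect to $\mathbf a=(a_1,\dots,a_m)\in\mathbb Z^m$, and let $A=C[a_1,\dots,a_m]$. Let $A$ and $K$ be oriented, with rep-polynomials $P_A(u)$, $P_K(u)$, and let $(u_1,\dots,u_m)$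 be the $u_i$-sequence of $A$. (i) If $K$ is a knot, then $P_A(u)$ divides $P_K(u)$ in $\mathbb Z[u]$. If $K$ is a link with more than one component, then $P_A(u)$ divides $P_K(u)$ in $\mathbb Z[u]$ or $P_A(u)$ divides $P_K(iu)$ in $\mathbb C[u]$. (ii) The polynomial $u$ divides $P_A(u)$. The directions that the orientation of $A$ gives to the two top bridges always extend to an orientation of $K$. If $K$ is a knot, or if the orientation of $K$ gives the two top bridges the same directions as that of $A$, or both the opposite directions, then the $u_i$-sequence of $K$, considered in $\mathbb Z[u]/\bigl(\tfrac1uP_A(u)\bigr)$, is $$(\pm u_1,\dots,\pm u_m,\,0,\,\pm u_m,\dots,\pm u_1,\,0,\,\pm u_1,\dots,\pm u_m,\,0,\dots)$$ with $n$ passes through $u_1,\dots,u_m$, alternately forward and backward, and with one undetermined sign for each entry. If the directions on the two top bridges are the same for $K$ and $A$, then the first $m$ entries are exactly $u_1,\dots,u_m$. -/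

import Mathlib

/-!
Conway diagrams `C[n₁, …, n_k]` of 2-bridge knots and links, their symplectic quandle colourings,
the `u_i`-sequence, the rep-polynomial, and ORS-expansions.

The diagram is read from top to bottom.  Every horizontal line that avoids the crossings meets it in
four points, the positions `0, 1, 2, 3` from left to right.  At the top there are two bridges, one
joining positions `0, 1` (its arc is coloured by the vector `a`) and one joining positions `2, 3`
(its arc is coloured by the vector `b`).  The odd-numbered twist blocks lie between positions
`1, 2`, the even-numbered ones between positions `0, 1`; the strand at position `3` runs straight
down.  At the bottom the strands are closed by two bridges.
-/

open Polynomial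

namespace TwoBridge

noncomputable section

/-- Colouring vectors, with coordinates in `ℤ[u]` (the variable `u` is `X`). -/
abbrev Vec : Type := Fin 2 → ℤ[X]

/-- The symplectic form `⟨x, y⟩ = x₁ y₂ - x₂ y₁`. -/
def symp (x y : Vec) : ℤ[X] := x 0 * y 1 - x 1 * y 0

/-- The symplectic quandle operations: `x ▷ y = x + ⟨x, y⟩ y` for `δ = 1`, and
`x ▷⁻¹ y = x - ⟨x, y⟩ y` for `δ = -1`. -/
def quandleOp (δ : ℤˣ) (x y : Vec) : Vec := x + ((δ : ℤ) • symp x y) • y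

/-- A choice of directions for the two top bridges: `a` is the direction at position `1` and `b` the
direction at position `2`, where `1` means downward and `-1` upward. -/
@[ext]
structure Orientation where
  a : ℤˣ
  b : ℤˣ

/-- The simultaneous reversal of both directions. -/
def Orientation.reverse (o : Orientation) : Orientation := ⟨-o.a, -o.b⟩

/-- The data on a horizontal line: the colouring vectors of the four arcs that are met and their
directions (`1` downward, `-1` upward). -/
structure Level where
  vec : Fin 4 → Vec
  dir : Fin 4 → ℤˣ

/-- The top of the diagram, with `a = (1, 0)` and `b = (0, u)`, so that `⟨a, b⟩ = u`. -/
def top (o : Orientation) : Level where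
  vec := ![![1, 0], ![1, 0], ![0, X], ![0, X]]
  dir := ![-o.a, o.a, o.b, -o.b]

/-- A crossing of the strands at positions `p` and `q` (`p` to the left of `q`) at which the strand
coming from the upper right passes over: `(x, y)` becomes `(y, -(x ▷ y))`, with `▷⁻¹` in place of
`▷` when the overcrossing strand is directed upward. -/
def rightOver (p q : Fin 4) (L : Level) : Level where
  vec := Function.update (Function.update L.vec p (L.vec q)) q
    (-quandleOp (L.dir q) (L.vec p) (L.vec q))
  dir := L.dir ∘ Equiv.swap p q

/-- The opposite crossing, at which the strand coming from the upper left passes over: `(x, y)`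
becomes `(-(y ▷⁻¹ x), x)`, with `▷` in place of `▷⁻¹` when the overcrossing strand is directed
upward. -/
def leftOver (p q : Fin 4) (L : Level) : Level where
  vec := Function.update (Function.update L.vec q (L.vec p)) p
    (-quandleOp (-L.dir p) (L.vec q) (L.vec p))
  dir := L.dir ∘ Equiv.swap p q

/-- `|n|` crossings, of the first kind if `n > 0` and of the second kind if `n < 0`. -/
def twist (p q : Fin 4) : ℤ → Level → Level
  | Int.ofNat n => (rightOver p q)^[n]
  | Int.negSucc n => (leftOver p q)^[n + 1]

/-- The position of the left strand of a block; `odd` tells whether the number of the block is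
odd. -/
def leftPos (odd : Bool) : Fin 4 := if odd then 1 else 0

/-- The position of the right strand of a block. -/
def rightPos (odd : Bool) : Fin 4 := if odd then 2 else 1

/-- The effect of the block with entry `n`.  In `C[n₁, n₂, …]` the sign convention of the
even-numbered blocks is opposite to that of the odd-numbered ones. -/
def block (odd : Bool) (n : ℤ) (L : Level) : Level :=
  twist (leftPos odd) (rightPos odd) (if odd then n else -n) L

/-- The level reached after descending through consecutive blocks, the first of which has odd or
even number as told by the flag. -/
def descend : Bool → List ℤ → Level → Level
  | _, [], L => L
  | odd, n :: ns, L => descend (!odd) ns (block odd n L)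

/-- The determinants `⟨a_{i,0}, b_{i,0}⟩` of the two vectors entering each of the blocks. -/
def blockDets : Bool → List ℤ → Level → List ℤ[X]
  | _, [], _ => []
  | odd, n :: ns, L =>
      symp (L.vec (leftPos odd)) (L.vec (rightPos odd)) :: blockDets (!odd) ns (block odd n L)

/-- The bottom of `C[n₁, …, n_k]`, before it is closed. -/
def bottom (ns : List ℤ) (o : Orientation) : Level := descend true ns (top o)

/-- The `u_i`-sequence `(u₁, …, u_k)` of `C[n₁, …, n_k]`. -/
def uSeq (ns : List ℤ) (o : Orientation) : List ℤ[X] := blockDets true ns (top o)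

/-- The two bridges at the top join positions `0, 1` and positions `2, 3`. -/
def topBridge : Fin 4 → Fin 4 := ![1, 0, 3, 2]

/-- The two bridges at the bottom of a diagram with `k` blocks: they join positions `0, 1` and
`2, 3` if `k` is odd, and positions `0, 3` and `1, 2` if `k` is even. -/
def bottomBridge (k : ℕ) : Fin 4 → Fin 4 := if Even k then ![3, 2, 1, 0] else ![1, 0, 3, 2]

/-- The directions chosen for the top bridges extend to an orientation of the whole diagram: the
bottom bridges join strands of opposite direction. -/
def IsOrientation (ns : List ℤ) (o : Orientation) : Prop :=
  ∀ p, (bottom ns o).dir (bottomBridge ns.length p) = -(bottom ns o).dir p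

/-- `⟨b_{k,f}, b⟩` if `k` is odd, `⟨a_{k,f}, b⟩` if `k` is even.  This is the pairing of the two
vectors at the ends of the bottom bridge that ends at position `3`. -/
def closingDet (ns : List ℤ) (o : Orientation) : ℤ[X] :=
  symp ((bottom ns o).vec (bottomBridge ns.length 3)) ((bottom ns o).vec 3)

/-- The rep-polynomial: the closing determinant, with its sign chosen so that the leading
coefficient is positive. -/
def repPoly (ns : List ℤ) (o : Orientation) : ℤ[X] :=
  C (closingDet ns o).leadingCoeff.sign * closingDet ns o

/-- The position at the top of the strand that arrives at a given position after consecutive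
blocks. -/
def strandPerm : Bool → List ℤ → Equiv.Perm (Fin 4)
  | _, [] => 1
  | odd, n :: ns => Equiv.swap (leftPos odd) (rightPos odd) ^ n * strandPerm (!odd) ns

/-- Two of the four strands (named by their top positions) are joined by a bridge. -/
def StrandsJoined (ns : List ℤ) (s t : Fin 4) : Prop :=
  t = topBridge s ∨
    ∃ p, s = strandPerm true ns p ∧ t = strandPerm true ns (bottomBridge ns.length p)

/-- `C[n₁, …, n_k]` is a knot: all its strands lie on one component. -/
def IsKnot (ns : List ℤ) : Prop := ∀ s t, Relation.EqvGen (StrandsJoined ns) s t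

/-- The block `ε 𝐚` or `ε 𝐚⁻¹` in place `i` (counted from `0`) of an ORS-expansion. -/
def orsBlock (a : List ℤ) (ε : ℤˣ) (i : ℕ) : List ℤ :=
  (if Even i then a else a.reverse).map fun x => (ε : ℤ) * x

/-- The sequence `ε₁ 𝐚, 2c₁, ε₂ 𝐚⁻¹, 2c₂, ε₃ 𝐚, …` with `n` blocks `± 𝐚^{± 1}`; the indices of `ε`
and `c` are counted from `0`. -/
def orsSeq (a : List ℤ) (ε : ℕ → ℤˣ) (c : ℕ → ℤ) : ℕ → List ℤ
  | 0 => []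
  | 1 => orsBlock a (ε 0) 0
  | n + 2 => orsSeq a ε c (n + 1) ++ 2 * c n :: orsBlock a (ε (n + 1)) (n + 1)

/-- The diagram `C[ns]` is an ORS-expansion of type `n` with respect to `a`. -/
def IsORSExpansion (ns : List ℤ) (n : ℕ) (a : List ℤ) : Prop :=
  1 ≤ n ∧ ∃ (ε : ℕ → ℤˣ) (c : ℕ → ℤ), ε 0 = 1 ∧ ns = orsSeq a ε c n

/-- The sequence `(u₁, …, u_m, 0, u_m, …, u₁, 0, u₁, …, u_m, 0, …)` in which `us = (u₁, …, u_m)`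
occurs `n` times, alternately forward and backward. -/
def zigzag (us : List ℤ[X]) : ℕ → List ℤ[X]
  | 0 => []
  | 1 => us
  | n + 2 => zigzag us (n + 1) ++ 0 :: (if Even (n + 1) then us else us.reverse)

/-- Two sequences of polynomials have the same length and agree modulo `q`, entry by entry, up to a
sign for each entry. -/
def AgreeUpToSign (q : ℤ[X]) (us vs : List ℤ[X]) : Prop :=
  List.Forall₂ (fun f g => Ideal.Quotient.mk (Ideal.span {q}) f = Ideal.Quotient.mk _ g ∨
    Ideal.Quotient.mk (Ideal.span {q}) f = -Ideal.Quotient.mk _ g) us vs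

/-- The polynomial `P(u)` with complex coefficients. -/
def toComplex (P : ℤ[X]) : ℂ[X] := P.map (Int.castRingHom ℂ)

/-- The polynomial `P(iu)`. -/
def substI (P : ℤ[X]) : ℂ[X] := (toComplex P).comp (C Complex.I * X)

end

end TwoBridge

namespace TwoBridge

noncomputable section

/-! A coloured strand acts on `Vec` by a transvection. The strand at position 3 always carries `b =
(0, u)`, so the closing determinant of `A` is `u` times the first coordinate of the other vector on
its bottom bridge. That coordinate is `q = P_A / u` up to sign, and everything is done modulo `q`.
There the two ends of this bridge are parallel.

The product of the four transvections on a level is trivial. Comparing traces of its two halves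
shows that the ends of the other bottom bridge are parallel too. As the first coordinates on a level
generate the unit ideal, these ends lie along a line which a shear fixing the direction of `b`
reflects. Hence the bottom of `A` agrees with its own view from behind (`behind`) up to signs and
such a shear, that is, up to `Cong` (`cong_behind_bottom`); the top always does.

Seen from behind every crossing changes type. So both `𝐚` and `-𝐚` lead from the top of `A` to its
bottom up to `Cong`, and both signs of `𝐚⁻¹` lead back up, one sign by literal retracing
(`pass_down`, `pass_up`). Each block `2c` twists parallel strands and changes only signs. Induction
on the type (`cong_bottom_orsSeq`) gives the `u_i`-sequence, the orientation and the divisibility.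

This treats `K` with the orientation of `A`. Reversing both bridges reflects the colouring;
reversing one amounts to `u ↦ iu`; a knot has only two orientations. -/

/-! ### Algebra of symplectic transvections -/

theorem quandleOp_apply (δ : ℤˣ) (x y : Vec) (i : Fin 2) :
    quandleOp δ x y i = x i + ((δ : ℤ) : ℤ[X]) * (x 0 * y 1 - x 1 * y 0) * y i := by
  simp [quandleOp, symp]

theorem quandleOp_neg_left (δ : ℤˣ) (x y : Vec) : quandleOp δ (-x) y = -quandleOp δ x y := by
  ext1 i; simp only [quandleOp_apply, Pi.neg_apply]; ring

theorem quandleOp_neg_right (δ : ℤˣ) (x y : Vec) : quandleOp δ x (-y) = quandleOp δ x y := by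
  ext1 i; simp only [quandleOp_apply, Pi.neg_apply]; ring

theorem quandleOp_neg_cancel (δ : ℤˣ) (x y : Vec) : quandleOp (-δ) (quandleOp δ x y) y = x := by
  ext1 i; simp only [quandleOp_apply, Units.val_neg]; push_cast; ring

theorem quandleOp_cancel_neg (δ : ℤˣ) (x y : Vec) : quandleOp δ (quandleOp (-δ) x y) y = x := by
  ext1 i; simp only [quandleOp_apply, Units.val_neg]; push_cast; ring

/-- Transvections preserve `symp`, so conjugating the transvection along `x` by another gives the
transvection along the image of `x`. -/
theorem quandleOp_distrib (δ ε : ℤˣ) (x y z : Vec) :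
    quandleOp ε (quandleOp δ z y) (quandleOp δ x y) = quandleOp δ (quandleOp ε z x) y := by
  ext1 i; simp only [quandleOp_apply]; ring

theorem symp_quandleOp_right (δ : ℤˣ) (x y : Vec) : symp x (quandleOp δ y x) = symp x y := by
  simp only [symp, quandleOp_apply]; ring

theorem symp_quandleOp_quandleOp (δ : ℤˣ) (x y z : Vec) :
    symp (quandleOp δ x z) (quandleOp δ y z) = symp x y := by
  simp only [symp, quandleOp_apply]; ring

/-- Reflection in the first coordinate axis. -/
def conj (x : Vec) : Vec := ![x 0, -x 1]

theorem conj_neg (x : Vec) : conj (-x) = -conj x := by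
  ext1 i; fin_cases i <;> simp [conj]

/-- A reflection has determinant `-1`, hence inverts the sign of a transvection. -/
theorem quandleOp_conj (δ : ℤˣ) (x y : Vec) :
    quandleOp δ (conj x) (conj y) = conj (quandleOp (-δ) x y) := by
  ext1 i; fin_cases i <;> simp [conj, quandleOp_apply] <;> ring

theorem symp_conj (x y : Vec) : symp (conj x) (conj y) = -symp x y := by
  simp [conj, symp]; ring

/-! ### Crossings -/

theorem leftOver_rightOver {p q : Fin 4} (h : p ≠ q) (L : Level) :
    leftOver p q (rightOver p q L) = L := by
  obtain ⟨v, d⟩ := L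
  simp only [leftOver, rightOver, Level.mk.injEq]
  constructor
  · ext1 r
    by_cases hp : r = p
    · subst hp
      simp [Function.update_of_ne h, quandleOp_neg_left, quandleOp_neg_cancel]
    · by_cases hq : r = q
      · subst hq; simp [Function.update_of_ne h, Function.update_of_ne hp]
      · simp [hp, hq]
  · ext1 r; simp

theorem rightOver_leftOver {p q : Fin 4} (h : p ≠ q) (L : Level) :
    rightOver p q (leftOver p q L) = L := by
  obtain ⟨v, d⟩ := L
  simp only [leftOver, rightOver, Level.mk.injEq]
  constructor
  · ext1 r
    by_cases hp : r = p
    · subst hp; simp [Function.update_of_ne h, Function.update_of_ne h.symm]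
    · by_cases hq : r = q
      · subst hq
        simp [Function.update_of_ne h.symm, quandleOp_neg_left, quandleOp_cancel_neg]
      · simp [hp, hq]
  · ext1 r; simp

theorem symp_rightOver {p q : Fin 4} (h : p ≠ q) (L : Level) :
    symp ((rightOver p q L).vec p) ((rightOver p q L).vec q) = symp (L.vec p) (L.vec q) := by
  simp [rightOver, Function.update_of_ne h, symp, quandleOp_apply]; ring

theorem symp_leftOver {p q : Fin 4} (h : p ≠ q) (L : Level) :
    symp ((leftOver p q L).vec p) ((leftOver p q L).vec q) = symp (L.vec p) (L.vec q) := by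
  rw [← symp_rightOver h, rightOver_leftOver h]

theorem leftPos_ne_rightPos (odd : Bool) : leftPos odd ≠ rightPos odd := by
  cases odd <;> decide

/-- A property of levels preserved by the crossings is preserved by twists. -/
theorem twist_induction {P : Level → Prop} {p q : Fin 4}
    (hr : ∀ L, P L → P (rightOver p q L)) (hl : ∀ L, P L → P (leftOver p q L)) (n : ℤ)
    {L : Level} (hL : P L) : P (twist p q n L) := by
  cases n with
  | ofNat n =>
    change P ((rightOver p q)^[n] L)
    induction n with
    | zero => exact hL
    | succ n ih => rw [Function.iterate_succ_apply']; exact hr _ ih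
  | negSucc n =>
    change P ((leftOver p q)^[n + 1] L)
    induction n with
    | zero => exact hl _ hL
    | succ n ih => rw [Function.iterate_succ_apply']; exact hl _ ih

/-- A relation between levels preserved by the crossings is preserved by twists. -/
theorem twist_rel {P : Level → Level → Prop} {p q : Fin 4}
    (hr : ∀ L L', P L L' → P (rightOver p q L) (rightOver p q L'))
    (hl : ∀ L L', P L L' → P (leftOver p q L) (leftOver p q L')) (n : ℤ)
    {L L' : Level} (hL : P L L') : P (twist p q n L) (twist p q n L') := by
  cases n with
  | ofNat n =>
    change P ((rightOver p q)^[n] L) ((rightOver p q)^[n] L')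
    induction n with
    | zero => exact hL
    | succ n ih => simp only [Function.iterate_succ_apply']; exact hr _ _ ih
  | negSucc n =>
    change P ((leftOver p q)^[n + 1] L) ((leftOver p q)^[n + 1] L')
    induction n with
    | zero => exact hl _ _ hL
    | succ n ih =>
      rw [Function.iterate_succ_apply', Function.iterate_succ_apply' _ (n + 1)]
      exact hl _ _ ih

theorem descend_induction {P : Level → Prop}
    (hr : ∀ odd L, P L → P (rightOver (leftPos odd) (rightPos odd) L))
    (hl : ∀ odd L, P L → P (leftOver (leftPos odd) (rightPos odd) L)) (odd : Bool) (ns : List ℤ)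
    {L : Level} (hL : P L) : P (descend odd ns L) := by
  induction ns generalizing odd L with
  | nil => exact hL
  | cons n ns ih => exact ih _ (twist_induction (hr odd) (hl odd) _ hL)

theorem descend_rel {P : Level → Level → Prop}
    (hr : ∀ odd L L', P L L' → P (rightOver (leftPos odd) (rightPos odd) L)
      (rightOver (leftPos odd) (rightPos odd) L'))
    (hl : ∀ odd L L', P L L' → P (leftOver (leftPos odd) (rightPos odd) L)
      (leftOver (leftPos odd) (rightPos odd) L')) (odd : Bool) (ns : List ℤ)
    {L L' : Level} (hL : P L L') : P (descend odd ns L) (descend odd ns L') := by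
  induction ns generalizing odd L L' with
  | nil => exact hL
  | cons n ns ih => exact ih _ (twist_rel (hr odd) (hl odd) _ hL)

theorem twist_neg_twist {p q : Fin 4} (h : p ≠ q) (n : ℤ) (L : Level) :
    twist p q (-n) (twist p q n L) = L := by
  cases n with
  | ofNat n =>
    cases n with
    | zero => rfl
    | succ n =>
      change (leftOver p q)^[n + 1] ((rightOver p q)^[n + 1] L) = L
      exact Function.LeftInverse.iterate (leftOver_rightOver h) (n + 1) L
  | negSucc n =>
    change (rightOver p q)^[n + 1] ((leftOver p q)^[n + 1] L) = L
    exact Function.LeftInverse.iterate (rightOver_leftOver h) (n + 1) L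

theorem block_neg_block (odd : Bool) (n : ℤ) (L : Level) :
    block odd (-n) (block odd n L) = L := by
  have := twist_neg_twist (leftPos_ne_rightPos odd) (if odd then n else -n) L
  cases odd <;> simpa [block] using this

theorem symp_block (odd : Bool) (n : ℤ) (L : Level) :
    symp ((block odd n L).vec (leftPos odd)) ((block odd n L).vec (rightPos odd)) =
      symp (L.vec (leftPos odd)) (L.vec (rightPos odd)) :=
  twist_induction (P := fun L' => symp (L'.vec (leftPos odd)) (L'.vec (rightPos odd)) =
      symp (L.vec (leftPos odd)) (L.vec (rightPos odd)))
    (fun L' h => (symp_rightOver (leftPos_ne_rightPos odd) L').trans h)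
    (fun L' h => (symp_leftOver (leftPos_ne_rightPos odd) L').trans h) _ rfl

/-- The parity flag of the block that follows `k` blocks, the first of which has flag `odd`. -/
def flagAfter (odd : Bool) : ℕ → Bool
  | 0 => odd
  | k + 1 => flagAfter (!odd) k

theorem flagAfter_not (odd : Bool) (k : ℕ) : flagAfter (!odd) k = !flagAfter odd k := by
  induction k generalizing odd with
  | zero => rfl
  | succ k ih => exact ih _

theorem flagAfter_eq (odd : Bool) (k : ℕ) :
    flagAfter odd k = if Even k then odd else !odd := by
  induction k with
  | zero => rfl
  | succ k ih =>
    rw [flagAfter, flagAfter_not, ih]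
    by_cases h : Even k <;> simp [h, Nat.even_add_one]

theorem descend_append (odd : Bool) (l₁ l₂ : List ℤ) (L : Level) :
    descend odd (l₁ ++ l₂) L = descend (flagAfter odd l₁.length) l₂ (descend odd l₁ L) := by
  induction l₁ generalizing odd L with
  | nil => rfl
  | cons n l₁ ih => exact ih _ _

theorem blockDets_append (odd : Bool) (l₁ l₂ : List ℤ) (L : Level) :
    blockDets odd (l₁ ++ l₂) L =
      blockDets odd l₁ L ++ blockDets (flagAfter odd l₁.length) l₂ (descend odd l₁ L) := by
  induction l₁ generalizing odd L with
  | nil => rfl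
  | cons n l₁ ih => exact congrArg _ (ih _ _)

theorem length_blockDets (odd : Bool) (l : List ℤ) (L : Level) :
    (blockDets odd l L).length = l.length := by
  induction l generalizing odd L with
  | nil => rfl
  | cons n l ih => simp [blockDets, ih]

/-- The reversed and negated sequence of blocks leads back to the start. -/
theorem descend_retrace (odd : Bool) (l : List ℤ) (L : Level) :
    descend (flagAfter odd (l.length + 1)) (l.reverse.map Neg.neg) (descend odd l L) = L := by
  induction l generalizing odd L with
  | nil => rfl
  | cons n l ih =>
    have h : flagAfter (flagAfter odd (l.length + 1 + 1)) l.length = odd := by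
      simp only [flagAfter_eq]
      by_cases h : Even l.length <;> simp [h, Nat.even_add_one]
    simp only [List.reverse_cons, List.map_append, descend_append, List.length_cons,
      List.length_map, List.length_reverse, List.map_cons, List.map_nil, h, descend]
    rw [show flagAfter odd (l.length + 1 + 1) = flagAfter (!odd) (l.length + 1) from rfl, ih,
      block_neg_block]

/-- Crossings inside a block preserve its determinant, so entering the block from below reads the
same value as from above. -/
theorem blockDets_retrace (odd : Bool) (l : List ℤ) (L : Level) :
    blockDets (flagAfter odd (l.length + 1)) (l.reverse.map Neg.neg) (descend odd l L) =
      (blockDets odd l L).reverse := by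
  induction l generalizing odd L with
  | nil => rfl
  | cons n l ih =>
    have h : flagAfter (flagAfter odd (l.length + 1 + 1)) l.length = odd := by
      simp only [flagAfter_eq]
      by_cases h : Even l.length <;> simp [h, Nat.even_add_one]
    simp only [List.reverse_cons, List.map_append, blockDets_append, List.length_cons,
      List.length_map, List.length_reverse, List.map_cons, List.map_nil, h, descend, blockDets]
    rw [show flagAfter odd (l.length + 1 + 1) = flagAfter (!odd) (l.length + 1) from rfl, ih,
      descend_retrace, symp_block]

/-! ### Directions -/

theorem dir_block (odd : Bool) (n : ℤ) (L : Level) :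
    (block odd n L).dir = L.dir ∘ (Equiv.swap (leftPos odd) (rightPos odd) ^ n : Equiv.Perm _) := by
  have key : ∀ (p q : Fin 4) (n : ℤ) (L : Level),
      (twist p q n L).dir = L.dir ∘ (Equiv.swap p q ^ n : Equiv.Perm _) := by
    intro p q n L
    cases n with
    | ofNat n =>
      change ((rightOver p q)^[n] L).dir = L.dir ∘ (Equiv.swap p q ^ n : Equiv.Perm _)
      induction n with
      | zero => rfl
      | succ n ih =>
        rw [Function.iterate_succ_apply', rightOver, ih, pow_succ]; rfl
    | negSucc n =>
      change ((leftOver p q)^[n + 1] L).dir = _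
      rw [zpow_negSucc, ← inv_pow, Equiv.swap_inv]
      induction n with
      | zero => rfl
      | succ n ih =>
        rw [Function.iterate_succ_apply', leftOver, ih, pow_succ _ (n + 1)]; rfl
  rw [block, key]
  cases odd
  · rw [if_neg Bool.false_ne_true, zpow_neg, ← inv_zpow, Equiv.swap_inv]
  · rfl

theorem dir_descend (odd : Bool) (ns : List ℤ) (L : Level) :
    (descend odd ns L).dir = L.dir ∘ strandPerm odd ns := by
  induction ns generalizing odd L with
  | nil => rfl
  | cons n ns ih => rw [descend, ih, dir_block, strandPerm]; rfl

/-- An orientation of a knot is determined up to reversal. -/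
theorem IsKnot.orientation_eq_or {ns : List ℤ} (h : IsKnot ns) {o o' : Orientation}
    (ho : IsOrientation ns o) (ho' : IsOrientation ns o') : o' = o ∨ o' = o.reverse := by
  -- The quotient of two orientations is a sign that is constant along each component.
  have key : ∀ s t, Relation.EqvGen (StrandsJoined ns) s t →
      (top o).dir s * (top o').dir s = (top o).dir t * (top o').dir t := by
    intro s t hst
    induction hst with
    | rel s t hst =>
      rcases hst with rfl | ⟨p, rfl, rfl⟩
      · fin_cases s <;> simp [top, topBridge]
      · have h1 := ho p
        have h2 := ho' p
        simp only [bottom, dir_descend, Function.comp_apply] at h1 h2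
        rw [h1, h2, neg_mul_neg]
    | refl => rfl
    | symm _ _ _ ih => exact ih.symm
    | trans _ _ _ _ _ ih1 ih2 => exact ih1.trans ih2
  have := key 1 2 (h 1 2)
  obtain ⟨a, b⟩ := o
  obtain ⟨a', b'⟩ := o'
  simp only [top, Orientation.reverse, Orientation.mk.injEq] at this ⊢
  rcases Int.units_eq_one_or a with rfl | rfl <;> rcases Int.units_eq_one_or b with rfl | rfl <;>
  rcases Int.units_eq_one_or a' with rfl | rfl <;> rcases Int.units_eq_one_or b' with rfl | rfl <;>
  revert this <;> decide

/-! ### Twisted levels -/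

section Twisted

variable {R : Type*} [CommRing R]

/-- Over the ring `R`, the vectors of `L'` arise from those of `L` by the linear map `M` and by
scaling every strand with an element of `S`, and the directions of `L'` are those that make this
compatible with the crossings. -/
def Twisted (φ ψ : ℤ[X] →+* R) (M : Matrix (Fin 2) (Fin 2) R) (S : Submonoid R)
    (L L' : Level) : Prop :=
  ∃ s : Fin 4 → R, (∀ p, s p ∈ S) ∧
    (∀ p i, φ (L'.vec p i) = s p * (M i 0 * ψ (L.vec p 0) + M i 1 * ψ (L.vec p 1))) ∧
    ∀ p, ((L'.dir p : ℤ) : R) * s p ^ 2 * M.det = ((L.dir p : ℤ) : R)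

variable {φ ψ : ℤ[X] →+* R} {M : Matrix (Fin 2) (Fin 2) R} {S : Submonoid R}

/-- `M` multiplies the form by its determinant and the scalar `t` of the acting strand enters
squared; `hε` says that the change of direction absorbs both factors. -/
theorem twisted_quandleOp {x y x' y' : Vec} {s t : R} {ε ε' : ℤˣ}
    (hx : ∀ i, φ (x' i) = s * (M i 0 * ψ (x 0) + M i 1 * ψ (x 1)))
    (hy : ∀ i, φ (y' i) = t * (M i 0 * ψ (y 0) + M i 1 * ψ (y 1)))
    (hε : ((ε' : ℤ) : R) * t ^ 2 * M.det = ((ε : ℤ) : R)) (i : Fin 2) :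
    φ (quandleOp ε' x' y' i) =
      s * (M i 0 * ψ (quandleOp ε x y 0) + M i 1 * ψ (quandleOp ε x y 1)) := by
  simp only [quandleOp_apply, map_add, map_mul, map_sub, map_intCast, hx, hy, ← hε,
    Matrix.det_fin_two]
  ring

theorem Twisted.rightOver {p q : Fin 4} (h : p ≠ q) {L L' : Level} (hL : Twisted φ ψ M S L L') :
    Twisted φ ψ M S (rightOver p q L) (rightOver p q L') := by
  obtain ⟨s, hs, hv, hd⟩ := hL
  refine ⟨s ∘ Equiv.swap p q, fun r => hs _, fun r i => ?_, fun r => hd _⟩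
  by_cases hq : r = q
  · subst hq
    have := twisted_quandleOp (hv p) (hv r) (hd r) i
    simp only [TwoBridge.rightOver, Function.update_self, Pi.neg_apply, map_neg, this,
      Function.comp_apply, Equiv.swap_apply_right]
    ring
  · by_cases hp : r = p
    · subst hp
      simp [TwoBridge.rightOver, Function.update_of_ne h, hv]
    · simp [TwoBridge.rightOver, hp, hq, hv, Equiv.swap_apply_of_ne_of_ne]

theorem Twisted.leftOver {p q : Fin 4} (h : p ≠ q) {L L' : Level} (hL : Twisted φ ψ M S L L') :
    Twisted φ ψ M S (leftOver p q L) (leftOver p q L') := by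
  obtain ⟨s, hs, hv, hd⟩ := hL
  refine ⟨s ∘ Equiv.swap p q, fun r => hs _, fun r i => ?_, fun r => hd _⟩
  by_cases hp : r = p
  · subst hp
    have hε : (((-L'.dir r : ℤˣ) : ℤ) : R) * s r ^ 2 * M.det = (((-L.dir r : ℤˣ) : ℤ) : R) := by
      rw [Units.val_neg, Units.val_neg, Int.cast_neg, Int.cast_neg, ← hd r]; ring
    have := twisted_quandleOp (hv q) (hv r) hε i
    simp only [TwoBridge.leftOver, Function.update_self, Pi.neg_apply, map_neg, this,
      Function.comp_apply, Equiv.swap_apply_left]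
    ring
  · by_cases hq : r = q
    · subst hq
      simp [TwoBridge.leftOver, Function.update_of_ne hp, hv]
    · simp [TwoBridge.leftOver, hp, hq, hv, Equiv.swap_apply_of_ne_of_ne]

theorem Twisted.block (odd : Bool) (n : ℤ) {L L' : Level} (hL : Twisted φ ψ M S L L') :
    Twisted φ ψ M S (block odd n L) (block odd n L') :=
  twist_rel (P := Twisted φ ψ M S) (fun _ _ => Twisted.rightOver (leftPos_ne_rightPos odd))
    (fun _ _ => Twisted.leftOver (leftPos_ne_rightPos odd)) _ hL

theorem Twisted.descend (odd : Bool) (ns : List ℤ) {L L' : Level} (hL : Twisted φ ψ M S L L') :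
    Twisted φ ψ M S (descend odd ns L) (descend odd ns L') :=
  descend_rel (P := Twisted φ ψ M S) (fun o _ _ => Twisted.rightOver (leftPos_ne_rightPos o))
    (fun o _ _ => Twisted.leftOver (leftPos_ne_rightPos o)) odd ns hL

theorem Twisted.symp {L L' : Level} (hL : Twisted φ ψ M S L L') (p q : Fin 4) :
    ∃ t ∈ S, φ (symp (L'.vec p) (L'.vec q)) = t * (M.det * ψ (symp (L.vec p) (L.vec q))) := by
  obtain ⟨s, hs, hv, -⟩ := hL
  refine ⟨s p * s q, S.mul_mem (hs p) (hs q), ?_⟩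
  simp only [TwoBridge.symp, map_sub, map_mul, hv, Matrix.det_fin_two]
  ring

theorem Twisted.blockDets (odd : Bool) (ns : List ℤ) {L L' : Level}
    (hL : Twisted φ ψ M S L L') :
    List.Forall₂ (fun f g => ∃ t ∈ S, φ g = t * (M.det * ψ f))
      (blockDets odd ns L) (blockDets odd ns L') := by
  induction ns generalizing odd L L' with
  | nil => exact .nil
  | cons n ns ih => exact .cons (hL.symp _ _) (ih _ (hL.block odd n))

/-- The submonoid `{1, -1}`. -/
def signs (R : Type*) [CommRing R] : Submonoid R where
  carrier := {x | x = 1 ∨ x = -1}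
  one_mem' := Or.inl rfl
  mul_mem' := by rintro _ _ (rfl | rfl) (rfl | rfl) <;> simp

theorem mem_signs {x : R} : x ∈ signs R ↔ x = 1 ∨ x = -1 := Iff.rfl

theorem sq_of_mem_signs {x : R} (h : x ∈ signs R) : x ^ 2 = 1 := by
  rcases h with rfl | rfl <;> simp

end Twisted

/-- Reversing the orientation reflects the colouring. -/
theorem twisted_reverse (o : Orientation) :
    Twisted (RingHom.id ℤ[X]) (RingHom.id ℤ[X]) !![1, 0; 0, -1] (signs ℤ[X])
      (top o) (top o.reverse) := by
  refine ⟨![1, 1, -1, -1], fun p => ?_, fun p i => ?_, fun p => ?_⟩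
  · fin_cases p <;> simp [mem_signs]
  · fin_cases p <;> fin_cases i <;> simp [top]
  · fin_cases p <;> simp [top, Orientation.reverse, Matrix.det_fin_two]

/-- Equality up to sign after application of a ring homomorphism. -/
def EqUpToSign {R : Type*} [CommRing R] (φ : ℤ[X] →+* R) (f g : ℤ[X]) : Prop :=
  φ f = φ g ∨ φ f = -φ g

theorem EqUpToSign.trans {R : Type*} [CommRing R] {φ : ℤ[X] →+* R} {f g h : ℤ[X]}
    (h₁ : EqUpToSign φ f g) (h₂ : EqUpToSign φ g h) : EqUpToSign φ f h := by
  rcases h₁ with h₁ | h₁ <;> rcases h₂ with h₂ | h₂ <;> simp [EqUpToSign, h₁, h₂]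

theorem EqUpToSign.eq_zero {R : Type*} [CommRing R] {φ : ℤ[X] →+* R} {f g : ℤ[X]}
    (h : EqUpToSign φ f g) (hg : φ g = 0) : φ f = 0 := by
  rcases h with h | h <;> simp [h, hg]

theorem EqUpToSign.forall₂_trans {R : Type*} [CommRing R] {φ : ℤ[X] →+* R} {l₁ l₂ l₃ : List ℤ[X]}
    (h₁ : List.Forall₂ (EqUpToSign φ) l₁ l₂) (h₂ : List.Forall₂ (EqUpToSign φ) l₂ l₃) :
    List.Forall₂ (EqUpToSign φ) l₁ l₃ := by
  induction h₁ generalizing l₃ with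
  | nil => exact h₂
  | cons h _ ih =>
    cases h₂ with
    | cons h' h₂' => exact .cons (h.trans h') (ih h₂')

theorem uSeq_reverse (ns : List ℤ) (o : Orientation) {R : Type*} [CommRing R]
    (φ : ℤ[X] →+* R) :
    List.Forall₂ (EqUpToSign φ) (uSeq ns o.reverse) (uSeq ns o) := by
  refine List.Forall₂.flip (List.Forall₂.imp ?_ ((twisted_reverse o).blockDets true ns))
  rintro f g ⟨t, ht, h⟩
  simp only [RingHom.id_apply, Matrix.det_fin_two] at h
  subst h
  rcases ht with rfl | rfl <;> simp [flip, EqUpToSign]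

theorem dvd_closingDet_reverse {ns : List ℤ} {o : Orientation} {P : ℤ[X]}
    (h : P ∣ closingDet ns o) : P ∣ closingDet ns o.reverse := by
  obtain ⟨t, -, ht⟩ := ((twisted_reverse o).descend true ns).symp (bottomBridge ns.length 3) 3
  change closingDet ns o.reverse = t * (_ * closingDet ns o) at ht
  rw [ht]
  exact Dvd.dvd.mul_left (Dvd.dvd.mul_left h _) _

/-- Substitution of `iu` for `u` as a ring homomorphism. -/
def substIHom : ℤ[X] →+* ℂ[X] :=
  (compRingHom (C Complex.I * X)).comp (mapRingHom (Int.castRingHom ℂ))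

theorem substIHom_apply (P : ℤ[X]) : substIHom P = substI P := rfl

/-- Reversing the direction of one of the two top bridges amounts to the substitution of `iu`
for `u`. -/
theorem toComplex_dvd_substI_closingDet {ns : List ℤ} {o o' : Orientation} {P : ℤ[X]}
    (ho : o' = ⟨o.a, -o.b⟩ ∨ o' = ⟨-o.a, o.b⟩) (h : P ∣ closingDet ns o) :
    toComplex P ∣ substI (closingDet ns o') := by
  have hI : (C Complex.I * C Complex.I : ℂ[X]) = -1 := by
    rw [← C_mul, Complex.I_mul_I, C_neg, C_1]
  have key : ∃ M, Twisted substIHom (mapRingHom (Int.castRingHom ℂ)) M ⊤ (top o) (top o') := by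
    rcases ho with rfl | rfl
    -- Scaling the `b`-strands by `i` reverses their directions because `i² = -1`, and turns `u`
    -- into `iu`.
    · refine ⟨!![1, 0; 0, 1], ![1, 1, C Complex.I, C Complex.I], fun p => trivial,
        fun p i => ?_, fun p => ?_⟩
      · fin_cases p <;> fin_cases i <;> simp [top, substIHom]
      · fin_cases p <;> simp [top, sq, hI, Matrix.det_fin_two]
    -- Here the `a`-strands are scaled by `i`; the matrix, of determinant 1, compensates on the
    -- vector `a` and supplies the factor `i` on `b`.
    · refine ⟨!![-C Complex.I, 0; 0, C Complex.I], ![C Complex.I, C Complex.I, 1, 1],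
        fun p => trivial, fun p i => ?_, fun p => ?_⟩
      · fin_cases p <;> fin_cases i <;> simp [top, substIHom, hI]
      · fin_cases p <;> simp [top, sq, hI, Matrix.det_fin_two]
  obtain ⟨M, hM⟩ := key
  obtain ⟨t, -, ht⟩ := (hM.descend true ns).symp (bottomBridge ns.length 3) 3
  change substI (closingDet ns o') = t * (_ * toComplex (closingDet ns o)) at ht
  rw [ht]
  exact Dvd.dvd.mul_left (Dvd.dvd.mul_left (_root_.map_dvd (mapRingHom (Int.castRingHom ℂ)) h) _) _

/-! ### Congruent levels -/

section Cong

variable {R : Type*} [CommRing R]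

/-- Over `R`, the vectors of `L'` agree up to signs with those of `L` after a shear that fixes the
direction of `b`; the directions are the same. -/
def Cong (φ : ℤ[X] →+* R) (L L' : Level) : Prop :=
  L'.dir = L.dir ∧ ∃ c : R, ∀ p, ∃ s ∈ signs R,
    φ (L'.vec p 0) = s * φ (L.vec p 0) ∧ φ (L'.vec p 1) = s * (φ (L.vec p 1) + c * φ (L.vec p 0))

variable {φ : ℤ[X] →+* R} {L L' L'' : Level}

theorem Cong.refl (φ : ℤ[X] →+* R) (L : Level) : Cong φ L L :=
  ⟨rfl, 0, fun p => ⟨1, one_mem _, by simp⟩⟩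

theorem Cong.symm (h : Cong φ L L') : Cong φ L' L := by
  obtain ⟨hd, c, h⟩ := h
  refine ⟨hd.symm, -c, fun p => ?_⟩
  obtain ⟨s, hs, h0, h1⟩ := h p
  refine ⟨s, hs, ?_, ?_⟩
  · rw [h0]; linear_combination -φ (L.vec p 0) * sq_of_mem_signs hs
  · rw [h0, h1]; linear_combination -φ (L.vec p 1) * sq_of_mem_signs hs

theorem Cong.trans (h : Cong φ L L') (h' : Cong φ L' L'') : Cong φ L L'' := by
  obtain ⟨hd, c, h⟩ := h
  obtain ⟨hd', c', h'⟩ := h'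
  refine ⟨hd'.trans hd, c + c', fun p => ?_⟩
  obtain ⟨s, hs, h0, h1⟩ := h p
  obtain ⟨s', hs', h0', h1'⟩ := h' p
  refine ⟨s' * s, mul_mem hs' hs, ?_, ?_⟩
  · rw [h0', h0]; ring
  · rw [h1', h0, h1]; ring

theorem Cong.exists_twisted (h : Cong φ L L') :
    ∃ c, Twisted φ φ !![1, 0; c, 1] (signs R) L L' := by
  obtain ⟨hd, c, h⟩ := h
  choose s hs h0 h1 using h
  refine ⟨c, s, hs, fun p i => ?_, fun p => ?_⟩
  · fin_cases i
    · simp [h0]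
    · simp [h1, add_comm]
  · simp [hd, sq_of_mem_signs (hs p), Matrix.det_fin_two]

theorem Twisted.cong {c : R} (h : Twisted φ φ !![1, 0; c, 1] (signs R) L L')
    (hd : L'.dir = L.dir) : Cong φ L L' := by
  obtain ⟨s, hs, h, -⟩ := h
  exact ⟨hd, c, fun p => ⟨s p, hs p, by simp [h], by simp [h, add_comm]⟩⟩

theorem Cong.descend (h : Cong φ L L') (odd : Bool) (ns : List ℤ) :
    Cong φ (descend odd ns L) (descend odd ns L') := by
  obtain ⟨c, hc⟩ := h.exists_twisted
  exact (hc.descend odd ns).cong (by rw [dir_descend, dir_descend, h.1])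

theorem Cong.rightOver {p q : Fin 4} (hpq : p ≠ q) (h : Cong φ L L') :
    Cong φ (rightOver p q L) (rightOver p q L') := by
  obtain ⟨c, hc⟩ := h.exists_twisted
  exact (hc.rightOver hpq).cong (by simp [TwoBridge.rightOver, h.1])

theorem Cong.leftOver {p q : Fin 4} (hpq : p ≠ q) (h : Cong φ L L') :
    Cong φ (leftOver p q L) (leftOver p q L') := by
  obtain ⟨c, hc⟩ := h.exists_twisted
  exact (hc.leftOver hpq).cong (by simp [TwoBridge.leftOver, h.1])

theorem Cong.symp (h : Cong φ L L') (p q : Fin 4) :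
    EqUpToSign φ (symp (L'.vec p) (L'.vec q)) (symp (L.vec p) (L.vec q)) := by
  obtain ⟨c, hc⟩ := h.exists_twisted
  obtain ⟨t, ht, h⟩ := hc.symp p q
  rcases ht with rfl | rfl <;> simp [EqUpToSign, h, Matrix.det_fin_two]

theorem Cong.blockDets (h : Cong φ L L') (odd : Bool) (ns : List ℤ) :
    List.Forall₂ (EqUpToSign φ) (blockDets odd ns L') (blockDets odd ns L) := by
  obtain ⟨c, hc⟩ := h.exists_twisted
  refine List.Forall₂.flip (List.Forall₂.imp ?_ (hc.blockDets odd ns))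
  rintro f g ⟨t, ht, h⟩
  rcases ht with rfl | rfl <;> simp [flip, EqUpToSign, h, Matrix.det_fin_two]

/-- Levels with the same directions whose vectors agree up to signs are congruent. -/
theorem Cong.of_eq_or_neg (hd : L'.dir = L.dir) (h : ∀ p, L'.vec p = L.vec p ∨ L'.vec p = -L.vec p) :
    Cong φ L L' := by
  refine ⟨hd, 0, fun p => ?_⟩
  rcases h p with h | h
  · exact ⟨1, Or.inl rfl, by simp [h]⟩
  · exact ⟨-1, Or.inr rfl, by simp [h]⟩

/-- Two crossings of strands with determinant `0` only change signs. -/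
theorem cong_rightOver_rightOver {p q : Fin 4} (hpq : p ≠ q)
    (h : φ (TwoBridge.symp (L.vec p) (L.vec q)) = 0) :
    Cong φ L (TwoBridge.rightOver p q (TwoBridge.rightOver p q L)) := by
  have h' : φ (L.vec p 0) * φ (L.vec q 1) - φ (L.vec p 1) * φ (L.vec q 0) = 0 := by
    simpa [TwoBridge.symp] using h
  refine ⟨?_, 0, fun r => ?_⟩
  · ext1 r; simp [TwoBridge.rightOver]
  by_cases hq : r = q
  · subst hq
    refine ⟨-1, Or.inr rfl, ?_⟩
    constructor <;>
    simp only [TwoBridge.rightOver, Function.update_self, Function.update_of_ne hpq,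
      Pi.neg_apply, quandleOp_apply, map_add, map_neg, map_mul, map_sub, map_intCast]
    · linear_combination (((L.dir ∘ Equiv.swap p r) r : ℤ) : R) *
        (φ (L.vec p 0) + ((L.dir r : ℤ) : R) *
          (φ (L.vec p 0) * φ (L.vec r 1) - φ (L.vec p 1) * φ (L.vec r 0)) * φ (L.vec r 0)) * h'
    · linear_combination (((L.dir ∘ Equiv.swap p r) r : ℤ) : R) *
        (φ (L.vec p 1) + ((L.dir r : ℤ) : R) *
          (φ (L.vec p 0) * φ (L.vec r 1) - φ (L.vec p 1) * φ (L.vec r 0)) * φ (L.vec r 1)) * h'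
  · by_cases hp : r = p
    · subst hp
      refine ⟨-1, Or.inr rfl, ?_⟩
      constructor <;>
      simp only [TwoBridge.rightOver, Function.update_self, Function.update_of_ne hpq,
        Pi.neg_apply, quandleOp_apply, map_add, map_neg, map_mul, map_sub, map_intCast, h'] <;> ring
    · exact ⟨1, Or.inl rfl, by simp [TwoBridge.rightOver, hp, hq]⟩

theorem cong_leftOver_leftOver {p q : Fin 4} (hpq : p ≠ q)
    (h : φ (TwoBridge.symp (L.vec p) (L.vec q)) = 0) :
    Cong φ L (TwoBridge.leftOver p q (TwoBridge.leftOver p q L)) := by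
  have h1 := cong_rightOver_rightOver (L := TwoBridge.leftOver p q (TwoBridge.leftOver p q L)) hpq
    (by rwa [symp_leftOver hpq, symp_leftOver hpq])
  rw [rightOver_leftOver hpq, rightOver_leftOver hpq] at h1
  exact h1.symm

/-- Crossing parallel strands sends `(x, y)` to `(y, -x)` over `R`; an even number of crossings
restores the directions and the vectors up to sign. -/
theorem cong_twist_two_mul {p q : Fin 4} (hpq : p ≠ q)
    (h : φ (TwoBridge.symp (L.vec p) (L.vec q)) = 0) (c : ℤ) : Cong φ L (twist p q (2 * c) L) := by
  obtain ⟨k, rfl | rfl⟩ := c.eq_nat_or_neg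
  · rw [show (2 * (k : ℤ)) = Int.ofNat (2 * k) by simp]
    change Cong φ L ((TwoBridge.rightOver p q)^[2 * k] L)
    rw [Function.iterate_mul]
    induction k with
    | zero => exact Cong.refl _ _
    | succ k ih =>
      rw [Function.iterate_succ_apply']
      refine ih.trans (cong_rightOver_rightOver hpq ?_)
      exact (ih.symp p q).eq_zero h
  · cases k with
    | zero => exact Cong.refl _ _
    | succ k =>
      rw [show (2 * -((k + 1 : ℕ) : ℤ)) = Int.negSucc (2 * k + 1) by
        rw [Int.negSucc_eq]; push_cast; ring]
      change Cong φ L ((TwoBridge.leftOver p q)^[2 * (k + 1)] L)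
      rw [Function.iterate_mul]
      induction (k + 1) with
      | zero => exact Cong.refl _ _
      | succ k ih =>
        rw [Function.iterate_succ_apply']
        refine ih.trans (cong_leftOver_leftOver hpq ?_)
        exact (ih.symp p q).eq_zero h

theorem cong_block_two_mul {odd : Bool}
    (h : φ (TwoBridge.symp (L.vec (leftPos odd)) (L.vec (rightPos odd))) = 0) (c : ℤ) :
    Cong φ L (block odd (2 * c) L) := by
  cases odd
  · simpa [block] using cong_twist_two_mul (leftPos_ne_rightPos false) h (-c)
  · exact cong_twist_two_mul (leftPos_ne_rightPos true) h c

end Cong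

/-! ### Invariants of the levels of a diagram -/

/-- The product of the transvections of the four strands is trivial. -/
def TrivialMonodromy (L : Level) : Prop :=
  ∀ v, quandleOp (L.dir 3) (quandleOp (L.dir 2) (quandleOp (L.dir 1) (quandleOp (L.dir 0) v
    (L.vec 0)) (L.vec 1)) (L.vec 2)) (L.vec 3) = v

/-- The first coordinates of the four vectors generate the unit ideal. -/
def FirstCoordsUnimodular (L : Level) : Prop :=
  ∃ c : Fin 4 → ℤ[X], ∑ p, c p * L.vec p 0 = 1

theorem quandleOp_pair_rightOver (δ ε : ℤˣ) (x y v : Vec) :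
    quandleOp ε (quandleOp δ v y) (-quandleOp δ x y) = quandleOp δ (quandleOp ε v x) y := by
  rw [quandleOp_neg_right, quandleOp_distrib]

theorem quandleOp_pair_leftOver (δ ε : ℤˣ) (x y v : Vec) :
    quandleOp δ (quandleOp ε v (-quandleOp (-δ) y x)) x = quandleOp ε (quandleOp δ v x) y := by
  rw [quandleOp_neg_right, ← quandleOp_distrib, quandleOp_cancel_neg]

/-- A crossing leaves the product of its two transvections unchanged, and at the top the two ends of
each bridge cancel. -/
theorem trivialMonodromy_bottom (ns : List ℤ) (o : Orientation) :
    TrivialMonodromy (bottom ns o) := by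
  refine descend_induction (fun odd L h v => ?_) (fun odd L h v => ?_) true ns fun v => ?_
  · have := h v
    cases odd <;> simpa [rightOver, leftPos, rightPos, Function.update, Equiv.swap_apply_def,
      quandleOp_pair_rightOver] using this
  · have := h v
    cases odd <;> simpa [leftOver, leftPos, rightPos, Function.update, Equiv.swap_apply_def,
      quandleOp_pair_leftOver] using this
  · simp [top, quandleOp_neg_cancel, quandleOp_cancel_neg]

/-- A crossing changes the first coordinates by an invertible matrix over `ℤ[X]`; the new
coefficients come from its inverse. At the top the coordinate of `a` is 1. -/
theorem firstCoordsUnimodular_bottom (ns : List ℤ) (o : Orientation) :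
    FirstCoordsUnimodular (bottom ns o) := by
  refine descend_induction (fun odd L h => ?_) (fun odd L h => ?_) true ns ?_
  · obtain ⟨c, hc⟩ := h
    rw [Fin.sum_univ_four] at hc
    cases odd
    · refine ⟨![c 1 + (-c 0) * ((L.dir 1 : ℤ) * symp (L.vec 0) (L.vec 1)), -c 0, c 2, c 3], ?_⟩
      rw [← hc]
      simp [Fin.sum_univ_four, rightOver, leftPos, rightPos, Function.update, quandleOp]
      ring
    · refine ⟨![c 0, c 2 + (-c 1) * ((L.dir 2 : ℤ) * symp (L.vec 1) (L.vec 2)), -c 1, c 3], ?_⟩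
      rw [← hc]
      simp [Fin.sum_univ_four, rightOver, leftPos, rightPos, Function.update, quandleOp]
      ring
  · obtain ⟨c, hc⟩ := h
    rw [Fin.sum_univ_four] at hc
    cases odd
    · refine ⟨![-c 1, c 0 + c 1 * ((L.dir 0 : ℤ) * symp (L.vec 1) (L.vec 0)), c 2, c 3], ?_⟩
      rw [← hc]
      simp [Fin.sum_univ_four, leftOver, leftPos, rightPos, Function.update, quandleOp]
      ring
    · refine ⟨![c 0, -c 2, c 1 + c 2 * ((L.dir 1 : ℤ) * symp (L.vec 2) (L.vec 1)), c 3], ?_⟩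
      rw [← hc]
      simp [Fin.sum_univ_four, leftOver, leftPos, rightPos, Function.update, quandleOp]
      ring
  · exact ⟨![1, 0, 0, 0], by simp [Fin.sum_univ_four, top]⟩

theorem vec_three_bottom (ns : List ℤ) (o : Orientation) : (bottom ns o).vec 3 = ![0, X] := by
  refine descend_induction (P := fun L => L.vec 3 = ![0, X]) (fun odd L h => ?_)
    (fun odd L h => ?_) true ns rfl
  · cases odd <;> simpa [rightOver, leftPos, rightPos, Function.update] using h
  · cases odd <;> simpa [leftOver, leftPos, rightPos, Function.update] using h

theorem closingDet_eq (ns : List ℤ) (o : Orientation) :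
    closingDet ns o = X * (bottom ns o).vec (bottomBridge ns.length 3) 0 := by
  simp [closingDet, vec_three_bottom, symp, mul_comm]

/-! ### The view from behind -/

/-- The colouring of a level as it is seen from behind, reflected so that directions are kept. -/
def behind (L : Level) : Level where
  -- Moving the base point behind the diagram conjugates a strand by those to its left. Position 3
  -- needs no correction: under `TrivialMonodromy` it would be trivial.
  vec := ![conj (L.vec 0), conj (quandleOp (-L.dir 0) (L.vec 1) (L.vec 0)),
    conj (quandleOp (-L.dir 0) (quandleOp (-L.dir 1) (L.vec 2) (L.vec 1)) (L.vec 0)),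
    conj (L.vec 3)]
  dir := L.dir

section Behind

variable {R : Type*} [CommRing R] {φ : ℤ[X] →+* R}

/-- From behind, the under-strand passes over. Self-distributivity matches the corrections by
strands to the left on both sides. -/
theorem cong_behind_rightOver (odd : Bool) (L : Level) :
    Cong φ (behind (rightOver (leftPos odd) (rightPos odd) L))
      (leftOver (leftPos odd) (rightPos odd) (behind L)) := by
  refine Cong.of_eq_or_neg rfl fun p => ?_
  have h1 : ∀ (δ ε : ℤˣ) (x y z : Vec), quandleOp (-δ) (quandleOp (-ε) z (quandleOp δ x y)) y =
      quandleOp (-ε) (quandleOp (-δ) z y) x := by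
    intro δ ε x y z
    rw [← quandleOp_distrib, quandleOp_neg_cancel]
  cases odd
  · fin_cases p
    · right
      simp [behind, rightOver, leftOver, leftPos, rightPos, Function.update, quandleOp_conj,
        quandleOp_cancel_neg]
    · right
      simp [behind, rightOver, leftOver, leftPos, rightPos, Function.update,
        quandleOp_neg_left, quandleOp_neg_cancel, conj_neg]
    · left
      simp [behind, rightOver, leftOver, leftPos, rightPos, Function.update,
        quandleOp_neg_right, h1]
    · left; simp [behind, rightOver, leftOver, leftPos, rightPos, Function.update]
  · fin_cases p
    · left; simp [behind, rightOver, leftOver, leftPos, rightPos, Function.update]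
    · right
      simp [behind, rightOver, leftOver, leftPos, rightPos, Function.update, quandleOp_conj,
        quandleOp_distrib, quandleOp_cancel_neg, Equiv.swap_apply_def]
    · right
      simp [behind, rightOver, leftOver, leftPos, rightPos, Function.update,
        quandleOp_neg_left, quandleOp_neg_cancel, conj_neg, Equiv.swap_apply_def]
    · left; simp [behind, rightOver, leftOver, leftPos, rightPos, Function.update]

theorem cong_behind_leftOver (odd : Bool) (L : Level) :
    Cong φ (behind (leftOver (leftPos odd) (rightPos odd) L))
      (rightOver (leftPos odd) (rightPos odd) (behind L)) := by
  have hne := leftPos_ne_rightPos odd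
  have := (cong_behind_rightOver (φ := φ) odd (leftOver (leftPos odd) (rightPos odd) L)).rightOver
    hne
  rw [rightOver_leftOver hne, rightOver_leftOver hne] at this
  have h2 := cong_behind_rightOver (φ := φ) odd (leftOver (leftPos odd) (rightPos odd) L)
  rw [rightOver_leftOver hne] at h2
  have h3 := h2.rightOver hne
  rw [rightOver_leftOver hne] at h3
  exact h3.symm

theorem cong_behind_block (odd : Bool) (n : ℤ) (L : Level) :
    Cong φ (behind (block odd n L)) (block odd (-n) (behind L)) := by
  have key : ∀ n : ℤ, Cong φ (behind (twist (leftPos odd) (rightPos odd) n L))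
      (twist (leftPos odd) (rightPos odd) (-n) (behind L)) := by
    intro n
    have hne := leftPos_ne_rightPos odd
    cases n with
    | ofNat n =>
      cases n with
      | zero => exact Cong.refl _ _
      | succ n =>
        change Cong φ (behind ((rightOver _ _)^[n + 1] L)) ((leftOver _ _)^[n + 1] (behind L))
        induction n + 1 with
        | zero => exact Cong.refl _ _
        | succ n ih =>
          rw [Function.iterate_succ_apply', Function.iterate_succ_apply']
          exact (cong_behind_rightOver odd _).trans (ih.leftOver hne)
    | negSucc n =>
      change Cong φ (behind ((leftOver _ _)^[n + 1] L)) ((rightOver _ _)^[n + 1] (behind L))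
      induction n + 1 with
      | zero => exact Cong.refl _ _
      | succ n ih =>
        rw [Function.iterate_succ_apply', Function.iterate_succ_apply']
        exact (cong_behind_leftOver odd _).trans (ih.rightOver hne)
  cases odd
  · exact key (-n)
  · exact key n

theorem cong_behind_descend (odd : Bool) (ns : List ℤ) (L : Level) :
    Cong φ (behind (descend odd ns L)) (descend odd (ns.map Neg.neg) (behind L)) := by
  induction ns generalizing odd L with
  | nil => exact Cong.refl _ _
  | cons n ns ih => exact (ih _ _).trans ((cong_behind_block odd n L).descend _ _)

theorem symp_behind (odd : Bool) (L : Level) :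
    symp ((behind L).vec (leftPos odd)) ((behind L).vec (rightPos odd)) =
      -symp (L.vec (leftPos odd)) (L.vec (rightPos odd)) := by
  cases odd <;> simp [behind, leftPos, rightPos, symp_conj, symp_quandleOp_right,
    symp_quandleOp_quandleOp]

theorem blockDets_behind (odd : Bool) (ns : List ℤ) (L : Level) :
    List.Forall₂ (EqUpToSign φ) (blockDets odd (ns.map Neg.neg) (behind L))
      (blockDets odd ns L) := by
  induction ns generalizing odd L with
  | nil => exact .nil
  | cons n ns ih =>
    exact .cons (Or.inr (by rw [symp_behind, map_neg]))
      (EqUpToSign.forall₂_trans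
        ((cong_behind_block odd n L).blockDets _ _) (ih _ _))

theorem cong_behind_top (o : Orientation) : Cong φ (top o) (behind (top o)) := by
  refine Cong.of_eq_or_neg rfl fun p => ?_
  fin_cases p <;> simp [behind, top, conj, quandleOp, symp]

/-! ### The bottom of a diagram whose closing determinant vanishes -/

theorem TrivialMonodromy.pair_eq {L : Level} (h : TrivialMonodromy L) (v : Vec) :
    quandleOp (L.dir 1) (quandleOp (L.dir 0) v (L.vec 0)) (L.vec 1) =
      quandleOp (-L.dir 2) (quandleOp (-L.dir 3) v (L.vec 3)) (L.vec 2) := by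
  conv_rhs => rw [← h v, quandleOp_neg_cancel, quandleOp_neg_cancel]

theorem TrivialMonodromy.middle_eq {L : Level} (h : TrivialMonodromy L) (v : Vec) :
    quandleOp (L.dir 2) (quandleOp (L.dir 1) v (L.vec 1)) (L.vec 2) =
      quandleOp (-L.dir 3) (quandleOp (-L.dir 0) v (L.vec 0)) (L.vec 3) := by
  have := h (quandleOp (-L.dir 0) v (L.vec 0))
  rw [quandleOp_cancel_neg] at this
  rw [← this, quandleOp_neg_cancel]

/-- The trace of a product of two transvections with opposite directions determines the determinant
of the vectors up to sign. -/
theorem symp_sq_eq_of_quandleOp_eq {δ ε : ℤˣ} {x y z w : Vec}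
    (h : ∀ v, quandleOp (-δ) (quandleOp δ v x) y = quandleOp (-ε) (quandleOp ε v z) w) :
    symp x y ^ 2 = symp z w ^ 2 := by
  -- The diagonal entries add up to the trace, which is 2 plus the square of the determinant.
  have h0 := congrFun (h ![1, 0]) 0
  have h1 := congrFun (h ![0, 1]) 1
  simp only [quandleOp_apply, Matrix.cons_val_zero, Matrix.cons_val_one] at h0 h1
  simp only [symp]
  rcases Int.units_eq_one_or δ with rfl | rfl <;> rcases Int.units_eq_one_or ε with rfl | rfl <;>
    push_cast at h0 h1 <;> linear_combination h0 + h1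

/-- Two parallel vectors with unimodular first coordinates are reflected by a shear. -/
theorem exists_shear_reflecting {a₀ a₁ b₀ b₁ c d : R} (h : a₀ * b₁ = a₁ * b₀)
    (hcd : c * a₀ + d * b₀ = 1) :
    ∃ k : R, a₁ + k * a₀ = -a₁ ∧ b₁ + k * b₀ = -b₁ :=
  -- `c * a₁ + d * b₁` is the common slope: times `a₀` it gives `a₁`, times `b₀` it gives `b₁`.
  ⟨-2 * (c * a₁ + d * b₁),
    by linear_combination -2 * a₁ * hcd - 2 * d * h,
    by linear_combination -2 * b₁ * hcd + 2 * c * h⟩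

end Behind

section Bottom

variable {R : Type*} [CommRing R] {φ : ℤ[X] →+* R}

theorem map_quandleOp_of_symp_eq_zero {x y : Vec} (h : φ (symp x y) = 0) (δ : ℤˣ) (i : Fin 2) :
    φ (quandleOp δ x y i) = φ (x i) := by
  have h' : φ (x 0 * y 1 - x 1 * y 0) = 0 := h
  rw [quandleOp_apply, map_add, map_mul, map_mul, h']
  ring

theorem symp_swap (x y : Vec) : symp y x = -symp x y := by
  simp only [symp]; ring

/-- The case in which the bottom bridges join positions `0, 1` and `2, 3`. -/
theorem cong_behind_of_adjacent_bridges {L : Level} (hm : TrivialMonodromy L)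
    (hu : FirstCoordsUnimodular L) (h3 : L.vec 3 = ![0, X]) (hd : L.dir 1 = -L.dir 0)
    (hd' : L.dir 3 = -L.dir 2) (hx : φ (L.vec 2 0) = 0) :
    φ (symp (L.vec 0) (L.vec 1)) = 0 ∧ Cong φ L (behind L) := by
  have h23 : φ (symp (L.vec 2) (L.vec 3)) = 0 := by simp [symp, h3, hx]
  have h01 : φ (symp (L.vec 0) (L.vec 1)) = 0 := by
    have := symp_sq_eq_of_quandleOp_eq (δ := L.dir 0) (ε := L.dir 2) (x := L.vec 0)
      (y := L.vec 1) (z := L.vec 3) (w := L.vec 2) fun v => by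
        have := hm.pair_eq v
        rwa [hd, hd', neg_neg] at this
    -- The square root is taken in the domain `ℤ[X]`, before passing to `R`, which may have
    -- nilpotents.
    rcases sq_eq_sq_iff_eq_or_eq_neg.mp this with h | h <;> simp [h, symp_swap (L.vec 2), h23]
  have h10 : φ (symp (L.vec 1) (L.vec 0)) = 0 := by rw [symp_swap, map_neg, h01, neg_zero]
  refine ⟨h01, rfl, ?_⟩
  have hpar : φ (L.vec 0 0) * φ (L.vec 1 1) = φ (L.vec 0 1) * φ (L.vec 1 0) := by
    rw [← sub_eq_zero, ← map_mul, ← map_mul, ← map_sub]; exact h01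
  have hx3 : L.vec 3 0 = 0 := by simp [h3]
  obtain ⟨c, hc⟩ := hu
  have hc' := congrArg φ hc
  simp only [Fin.sum_univ_four, map_add, map_mul, map_one, hx, hx3, mul_zero,
    add_zero] at hc'
  obtain ⟨k, hk0, hk1⟩ := exists_shear_reflecting hpar hc'
  -- Trivial monodromy trades the corrections by strands 0 and 1 for one by strand 3, which is
  -- parallel to strand 2 over `R`.
  have h2 : quandleOp (-L.dir 0) (quandleOp (-L.dir 1) (L.vec 2) (L.vec 1)) (L.vec 0) =
      quandleOp (L.dir 3) (L.vec 2) (L.vec 3) := by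
    have := hm (quandleOp (-L.dir 0) (quandleOp (-L.dir 1) (L.vec 2) (L.vec 1)) (L.vec 0))
    rw [quandleOp_cancel_neg, quandleOp_cancel_neg] at this
    rw [← this]
    congr 1
    ext1 i; simp only [quandleOp_apply]; ring
  refine ⟨k, fun p => ?_⟩
  fin_cases p
  · exact ⟨1, Or.inl rfl, by simp [behind, conj], by simp [behind, conj, hk0]⟩
  · exact ⟨1, Or.inl rfl, by simp [behind, conj, map_quandleOp_of_symp_eq_zero h10],
      by simp [behind, conj, hk1, map_quandleOp_of_symp_eq_zero h10]⟩
  · exact ⟨-1, Or.inr rfl, by simp [behind, conj, h2, map_quandleOp_of_symp_eq_zero h23, hx],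
      by simp [behind, conj, h2, map_quandleOp_of_symp_eq_zero h23, hx]⟩
  · exact ⟨-1, Or.inr rfl, by simp [behind, conj, h3], by simp [behind, conj, h3]⟩

/-- The case in which the bottom bridges join positions `0, 3` and `1, 2`. -/
theorem cong_behind_of_nested_bridges {L : Level} (hm : TrivialMonodromy L)
    (hu : FirstCoordsUnimodular L) (h3 : L.vec 3 = ![0, X]) (hd : L.dir 2 = -L.dir 1)
    (hd' : L.dir 3 = -L.dir 0) (hx : φ (L.vec 0 0) = 0) :
    φ (symp (L.vec 1) (L.vec 2)) = 0 ∧ Cong φ L (behind L) := by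
  have h03 : φ (symp (L.vec 0) (L.vec 3)) = 0 := by simp [symp, h3, hx]
  have h12 : φ (symp (L.vec 1) (L.vec 2)) = 0 := by
    have := symp_sq_eq_of_quandleOp_eq (δ := L.dir 1) (ε := -L.dir 0) (x := L.vec 1)
      (y := L.vec 2) (z := L.vec 0) (w := L.vec 3) fun v => by
        have := hm.middle_eq v
        rwa [hd, hd'] at this
    rcases sq_eq_sq_iff_eq_or_eq_neg.mp this with h | h <;> simp [h, h03]
  have h21 : φ (symp (L.vec 2) (L.vec 1)) = 0 := by rw [symp_swap, map_neg, h12, neg_zero]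
  refine ⟨h12, rfl, ?_⟩
  have hpar : φ (L.vec 1 0) * φ (L.vec 2 1) = φ (L.vec 1 1) * φ (L.vec 2 0) := by
    rw [← sub_eq_zero, ← map_mul, ← map_mul, ← map_sub]; exact h12
  have hx3 : L.vec 3 0 = 0 := by simp [h3]
  obtain ⟨c, hc⟩ := hu
  have hc' := congrArg φ hc
  simp only [Fin.sum_univ_four, map_add, map_mul, map_one, hx, hx3, mul_zero,
    add_zero, zero_add] at hc'
  obtain ⟨k, hk0, hk1⟩ := exists_shear_reflecting hpar hc'
  -- Over `R` the vector at position 0 lies in the direction of `b`, so its transvection is itself a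
  -- shear of the kind allowed in `Cong`; it contributes the second term of the shear constant
  -- below.
  have hq : ∀ (v w : Vec), (∀ i, φ (v i) = φ (w i)) →
      φ (quandleOp (-L.dir 0) v (L.vec 0) 0) = φ (w 0) ∧
      φ (quandleOp (-L.dir 0) v (L.vec 0) 1) =
        φ (w 1) - ((L.dir 0 : ℤ) : R) * φ (L.vec 0 1) ^ 2 * φ (w 0) := by
    intro v w h
    constructor <;> simp only [quandleOp_apply, map_add, map_mul, map_sub, map_intCast, hx, h,
      Units.val_neg, Int.cast_neg, map_neg] <;> ring
  have h1 := hq (L.vec 1) (L.vec 1) fun _ => rfl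
  have h2 := hq (quandleOp (-L.dir 1) (L.vec 2) (L.vec 1)) (L.vec 2)
    fun i => map_quandleOp_of_symp_eq_zero h21 _ i
  refine ⟨k + ((L.dir 0 : ℤ) : R) * φ (L.vec 0 1) ^ 2, fun p => ?_⟩
  fin_cases p
  · exact ⟨-1, Or.inr rfl, by simp [behind, conj, hx], by simp [behind, conj, hx]⟩
  · refine ⟨1, Or.inl rfl, by simp [behind, conj, h1.1], ?_⟩
    simp only [behind, conj, Fin.mk_one, Matrix.cons_val_one, Matrix.cons_val_zero, map_neg, h1.2]
    linear_combination -hk0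
  · refine ⟨1, Or.inl rfl, by simp [behind, conj, h2.1], ?_⟩
    simp only [behind, conj, Fin.reduceFinMk, Matrix.cons_val, Matrix.cons_val_one, map_neg, h2.2]
    linear_combination -hk1
  · exact ⟨-1, Or.inr rfl, by simp [behind, conj, h3], by simp [behind, conj, h3]⟩

/-- If the closing determinant vanishes over `R` after division by `u`, then so does the determinant
at the place of the next block, and the bottom of the diagram looks the same from behind. -/
theorem cong_behind_bottom {ns : List ℤ} {o : Orientation} (ho : IsOrientation ns o)
    (hx : φ ((bottom ns o).vec (bottomBridge ns.length 3) 0) = 0) :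
    φ (symp ((bottom ns o).vec (leftPos (flagAfter true ns.length)))
      ((bottom ns o).vec (rightPos (flagAfter true ns.length)))) = 0 ∧
    Cong φ (bottom ns o) (behind (bottom ns o)) := by
  have hm := trivialMonodromy_bottom ns o
  have hu := firstCoordsUnimodular_bottom ns o
  have h3 := vec_three_bottom ns o
  have h0 := ho 0
  have h1 := ho 1
  have h2 := ho 2
  rw [flagAfter_eq]
  by_cases he : Even ns.length
  · simp only [bottomBridge, he, if_true] at hx h0 h1 h2 ⊢
    exact cong_behind_of_nested_bridges hm hu h3 h1 h0 hx
  · simp only [bottomBridge, he, if_false] at hx h0 h1 h2 ⊢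
    exact cong_behind_of_adjacent_bridges hm hu h3 h0 h2 hx

end Bottom

/-! ### Expansions -/

section Expansion

variable {R : Type*} [CommRing R] {φ : ℤ[X] →+* R} {a : List ℤ} {o : Orientation}

theorem map_unit_mul (ε : ℤˣ) (l : List ℤ) :
    l.map (fun x => (ε : ℤ) * x) = l ∨ l.map (fun x => (ε : ℤ) * x) = l.map Neg.neg := by
  rcases Int.units_eq_one_or ε with rfl | rfl
  · left; simp
  · right; simp

theorem pass_down {L : Level} (hL : Cong φ (top o) L)
    (hB : Cong φ (bottom a o) (behind (bottom a o))) (ε : ℤˣ) :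
    Cong φ (bottom a o) (descend true (a.map fun x => (ε : ℤ) * x) L) ∧
      List.Forall₂ (EqUpToSign φ) (blockDets true (a.map fun x => (ε : ℤ) * x) L)
        (uSeq a o) := by
  rcases map_unit_mul ε a with h | h <;> rw [h]
  · exact ⟨hL.descend _ _, hL.blockDets _ _⟩
  · have h' := (cong_behind_top o).symm.trans hL
    exact ⟨(hB.trans (cong_behind_descend true a (top o))).trans (h'.descend _ _),
      EqUpToSign.forall₂_trans (h'.blockDets _ _) (blockDets_behind true a (top o))⟩

theorem pass_up {L : Level} (hL : Cong φ (bottom a o) L)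
    (hB : Cong φ (bottom a o) (behind (bottom a o))) (ε : ℤˣ) :
    Cong φ (top o) (descend (flagAfter true (a.length + 1))
        (a.reverse.map fun x => (ε : ℤ) * x) L) ∧
      List.Forall₂ (EqUpToSign φ) (blockDets (flagAfter true (a.length + 1))
        (a.reverse.map fun x => (ε : ℤ) * x) L) (uSeq a o).reverse := by
  have h₁ : descend (flagAfter true (a.length + 1)) (a.reverse.map Neg.neg) (bottom a o) = top o :=
    descend_retrace true a (top o)
  have h₂ : blockDets (flagAfter true (a.length + 1)) (a.reverse.map Neg.neg) (bottom a o) =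
      (uSeq a o).reverse := blockDets_retrace true a (top o)
  rcases map_unit_mul ε a.reverse with h | h <;> rw [h]
  · have h' := hB.symm.trans hL
    have hr : a.reverse = (a.reverse.map Neg.neg).map Neg.neg := by simp
    have h₃ := cong_behind_descend (φ := φ) (flagAfter true (a.length + 1))
      (a.reverse.map Neg.neg) (bottom a o)
    have h₄ := blockDets_behind (φ := φ) (flagAfter true (a.length + 1))
      (a.reverse.map Neg.neg) (bottom a o)
    rw [← hr, h₁] at h₃
    rw [← hr, h₂] at h₄
    exact ⟨((cong_behind_top o).trans h₃).trans (h'.descend _ _),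
      EqUpToSign.forall₂_trans (h'.blockDets _ _) h₄⟩
  · have h₃ := hL.descend (flagAfter true (a.length + 1)) (a.reverse.map Neg.neg)
    have h₄ := hL.blockDets (flagAfter true (a.length + 1)) (a.reverse.map Neg.neg)
    rw [h₁] at h₃
    rw [h₂] at h₄
    exact ⟨h₃, h₄⟩

theorem length_orsSeq (a : List ℤ) (ε : ℕ → ℤˣ) (c : ℕ → ℤ) (n : ℕ) :
    (orsSeq a ε c (n + 1)).length = (n + 1) * a.length + n := by
  have hb : ∀ ε i, (orsBlock a ε i).length = a.length := by
    intro ε i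
    simp only [orsBlock, List.length_map]
    split_ifs <;> simp
  induction n with
  | zero => simp [orsSeq, hb]
  | succ n ih =>
    simp only [orsSeq, List.length_append, List.length_cons, hb, ih]
    ring

theorem even_length_orsSeq_iff (a : List ℤ) (ε : ℕ → ℤˣ) (c : ℕ → ℤ) (n : ℕ) :
    Even (orsSeq a ε c (n + 1)).length ↔ Even n ∧ Even a.length := by
  rw [length_orsSeq]
  by_cases h : Even n <;> by_cases h' : Even a.length <;> simp [h, h', parity_simps]

/-- There are `n + 1` passes, so even `n` ends at the bottom of `A` and odd `n` at its top. The next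
`2c` then twists the two ends of a bridge: the bottom one away from position 3 (`hz`), or the top
bridge `a`. -/
theorem cong_bottom_orsSeq (hB : Cong φ (bottom a o) (behind (bottom a o)))
    (hz : φ (symp ((bottom a o).vec (leftPos (flagAfter true a.length)))
      ((bottom a o).vec (rightPos (flagAfter true a.length)))) = 0)
    (ε : ℕ → ℤˣ) (c : ℕ → ℤ) (n : ℕ) :
    Cong φ (if Even n then bottom a o else top o) (bottom (orsSeq a ε c (n + 1)) o) ∧
      List.Forall₂ (EqUpToSign φ) (uSeq (orsSeq a ε c (n + 1)) o)
        (zigzag (uSeq a o) (n + 1)) := by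
  induction n with
  | zero => exact pass_down (Cong.refl _ _) hB (ε 0)
  | succ n ih =>
    obtain ⟨ih₁, ih₂⟩ := ih
    rw [bottom.eq_def (orsSeq _ _ _ _), uSeq.eq_def (orsSeq _ _ _ _), orsSeq, descend_append,
      blockDets_append, zigzag, flagAfter_eq]
    change Cong φ _ (descend _ _ (block _ (2 * c n) (bottom (orsSeq a ε c (n + 1)) o))) ∧
      List.Forall₂ _ (uSeq (orsSeq a ε c (n + 1)) o ++
        symp ((bottom (orsSeq a ε c (n + 1)) o).vec (leftPos _))
          ((bottom (orsSeq a ε c (n + 1)) o).vec (rightPos _)) ::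
        blockDets _ _ (block _ (2 * c n) (bottom (orsSeq a ε c (n + 1)) o))) _
    generalize bottom (orsSeq a ε c (n + 1)) o = L at ih₁ ⊢
    simp only [even_length_orsSeq_iff, Nat.even_add_one]
    by_cases h : Even n
    · have hf : (if Even n ∧ Even a.length then true else !true) = flagAfter true a.length := by
        simp [h, flagAfter_eq]
      have hs : (!flagAfter true a.length) = flagAfter true (a.length + 1) :=
        (flagAfter_not true _).symm
      rw [hf, hs]
      simp only [h, if_true, not_true, if_false, orsBlock, Nat.even_add_one] at ih₁ ⊢
      have hL := (ih₁.symp (leftPos (flagAfter true a.length))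
        (rightPos (flagAfter true a.length))).eq_zero hz
      obtain ⟨h₁, h₂⟩ := pass_up (ih₁.trans (cong_block_two_mul hL (c n))) hB (ε (n + 1))
      exact ⟨h₁, List.rel_append ih₂ (.cons (Or.inl (by rw [hL, map_zero])) h₂)⟩
    -- The number of blocks so far is odd: `2c` falls on positions 0 and 1, and the next copy of `𝐚`
    -- starts with an odd-numbered block.
    · have hf : (if Even n ∧ Even a.length then true else !true) = false := by simp [h]
      rw [hf]
      simp only [h, not_false_eq_true, if_true, if_false, orsBlock, Nat.even_add_one] at ih₁ ⊢
      have hL : φ (symp (L.vec (leftPos false)) (L.vec (rightPos false))) = 0 :=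
        (ih₁.symp _ _).eq_zero (by simp [top, leftPos, rightPos, symp])
      obtain ⟨h₁, h₂⟩ := pass_down (ih₁.trans (cong_block_two_mul hL (c n))) hB (ε (n + 1))
      exact ⟨h₁, List.rel_append ih₂ (.cons (Or.inl (by rw [hL, map_zero])) h₂)⟩

theorem isOrientation_orsSeq (ho : IsOrientation a o)
    (hB : Cong φ (bottom a o) (behind (bottom a o)))
    (hz : φ (symp ((bottom a o).vec (leftPos (flagAfter true a.length)))
      ((bottom a o).vec (rightPos (flagAfter true a.length)))) = 0)
    (ε : ℕ → ℤˣ) (c : ℕ → ℤ) (n : ℕ) : IsOrientation (orsSeq a ε c (n + 1)) o := by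
  intro p
  have hd := (cong_bottom_orsSeq hB hz ε c n).1.1
  rw [hd, bottomBridge]
  simp only [even_length_orsSeq_iff]
  by_cases h : Even n
  · simp only [h, if_true, true_and]
    exact ho p
  · simp only [h, if_false, false_and]
    fin_cases p <;> simp [top]

theorem map_closing_orsSeq (hx : φ ((bottom a o).vec (bottomBridge a.length 3) 0) = 0)
    (hB : Cong φ (bottom a o) (behind (bottom a o)))
    (hz : φ (symp ((bottom a o).vec (leftPos (flagAfter true a.length)))
      ((bottom a o).vec (rightPos (flagAfter true a.length)))) = 0)
    (ε : ℕ → ℤˣ) (c : ℕ → ℤ) (n : ℕ) :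
    φ ((bottom (orsSeq a ε c (n + 1)) o).vec
      (bottomBridge (orsSeq a ε c (n + 1)).length 3) 0) = 0 := by
  obtain ⟨-, k, hk⟩ := (cong_bottom_orsSeq hB hz ε c n).1
  obtain ⟨s, -, hs, -⟩ := hk (bottomBridge (orsSeq a ε c (n + 1)).length 3)
  rw [hs]
  simp only [bottomBridge, even_length_orsSeq_iff] at hx ⊢
  by_cases h : Even n
  · simp only [h, if_true, true_and]
    rw [hx, mul_zero]
  · simp [h, top]

end Expansion

/-! ### Exact initial segment, signs and the four orientations -/

theorem take_uSeq_orsSeq (a : List ℤ) (o : Orientation) (ε : ℕ → ℤˣ) (hε : ε 0 = 1) (c : ℕ → ℤ)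
    (n : ℕ) : (uSeq (orsSeq a ε c (n + 1)) o).take a.length = uSeq a o := by
  have hp : a <+: orsSeq a ε c (n + 1) := by
    induction n with
    | zero => simp [orsSeq, orsBlock, hε]
    | succ n ih => exact ih.trans (List.prefix_append _ _)
  obtain ⟨l, hl⟩ := hp
  rw [← hl, uSeq, blockDets_append, List.take_left' (length_blockDets _ _ _), uSeq]

theorem repPoly_dvd_closingDet (ns : List ℤ) (o : Orientation) :
    repPoly ns o ∣ closingDet ns o := by
  by_cases h : closingDet ns o = 0
  · rw [h]; exact dvd_zero _
  · refine ⟨C (closingDet ns o).leadingCoeff.sign, ?_⟩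
    have h' : (closingDet ns o).leadingCoeff.sign * (closingDet ns o).leadingCoeff.sign = 1 := by
      rcases lt_or_gt_of_ne (leadingCoeff_ne_zero.mpr h) with h | h
      · rw [Int.sign_eq_neg_one_of_neg h]; rfl
      · rw [Int.sign_eq_one_of_pos h]; rfl
    rw [repPoly, mul_right_comm, ← C_mul, h', C_1, one_mul]

theorem Orientation.eq_or (o o' : Orientation) :
    (o' = o ∨ o' = o.reverse) ∨ o' = ⟨o.a, -o.b⟩ ∨ o' = ⟨-o.a, o.b⟩ := by
  obtain ⟨a, b⟩ := o
  obtain ⟨a', b'⟩ := o'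
  simp only [Orientation.reverse, Orientation.mk.injEq]
  rcases Int.units_eq_one_or a with rfl | rfl <;> rcases Int.units_eq_one_or b with rfl | rfl <;>
  rcases Int.units_eq_one_or a' with rfl | rfl <;> rcases Int.units_eq_one_or b' with rfl | rfl <;>
  decide

end

end TwoBridge

/-! ### The theorem -/

theorem theorem7p2 (K a : List ℤ) (n : ℕ) (hK : TwoBridge.IsORSExpansion K n a)
    (oA oK : TwoBridge.Orientation)
    (hoA : TwoBridge.IsOrientation a oA) (hoK : TwoBridge.IsOrientation K oK) :
    ((TwoBridge.IsKnot K → TwoBridge.repPoly a oA ∣ TwoBridge.repPoly K oK) ∧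
      (¬ TwoBridge.IsKnot K →
        TwoBridge.repPoly a oA ∣ TwoBridge.repPoly K oK ∨
        TwoBridge.toComplex (TwoBridge.repPoly a oA) ∣
          TwoBridge.substI (TwoBridge.repPoly K oK))) ∧
    TwoBridge.IsOrientation K oA ∧
    ∃ q : ℤ[X], TwoBridge.repPoly a oA = X * q ∧
      (TwoBridge.IsKnot K ∨ oK = oA ∨ oK = oA.reverse →
        TwoBridge.AgreeUpToSign q (TwoBridge.uSeq K oK)
          (TwoBridge.zigzag (TwoBridge.uSeq a oA) n)) ∧
      (oK = oA → (TwoBridge.uSeq K oK).take a.length = TwoBridge.uSeq a oA) := by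
  obtain ⟨hn, ε, c, hε, rfl⟩ := hK
  obtain ⟨n, rfl⟩ : ∃ k, n = k + 1 := ⟨n - 1, by omega⟩
  set x := (TwoBridge.bottom a oA).vec (TwoBridge.bottomBridge a.length 3) 0 with hx
  have hcl : TwoBridge.closingDet a oA = X * x := TwoBridge.closingDet_eq a oA
  -- The normalising sign is built into `q`. If the closing determinant is 0, then `q = 0` and the
  -- congruences are equalities in `ℤ[X]`.
  set q : ℤ[X] := C (TwoBridge.closingDet a oA).leadingCoeff.sign * x with hq
  have hrep : TwoBridge.repPoly a oA = X * q := by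
    rw [TwoBridge.repPoly, hq]
    nth_rewrite 2 [hcl]
    ring
  have hqx : q ∣ x := by
    have := TwoBridge.repPoly_dvd_closingDet a oA
    rw [hrep, hcl] at this
    exact (mul_dvd_mul_iff_left X_ne_zero).mp this
  let φ := Ideal.Quotient.mk (Ideal.span {q})
  have hφ : φ x = 0 := Ideal.Quotient.eq_zero_iff_dvd _ _ |>.mpr hqx
  obtain ⟨hz, hB⟩ := TwoBridge.cong_behind_bottom (φ := φ) hoA hφ
  have horient := TwoBridge.isOrientation_orsSeq hoA hB hz ε c n
  have hsame : TwoBridge.repPoly a oA ∣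
      TwoBridge.closingDet (TwoBridge.orsSeq a ε c (n + 1)) oA := by
    rw [hrep, TwoBridge.closingDet_eq]
    exact mul_dvd_mul_left X ((Ideal.Quotient.eq_zero_iff_dvd _ _).mp
      (TwoBridge.map_closing_orsSeq hφ hB hz ε c n))
  have hdvd : oK = oA ∨ oK = oA.reverse →
      TwoBridge.repPoly a oA ∣ TwoBridge.repPoly (TwoBridge.orsSeq a ε c (n + 1)) oK := by
    rintro (rfl | rfl)
    · exact Dvd.dvd.mul_left hsame _
    · exact Dvd.dvd.mul_left (TwoBridge.dvd_closingDet_reverse hsame) _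
  refine ⟨⟨fun hk => hdvd (hk.orientation_eq_or horient hoK), fun _ => ?_⟩, horient, q, hrep,
    fun h => ?_, ?_⟩
  · rcases TwoBridge.Orientation.eq_or oA oK with h | h
    · exact Or.inl (hdvd h)
    · right
      have := TwoBridge.toComplex_dvd_substI_closingDet h hsame
      rw [← TwoBridge.substIHom_apply, TwoBridge.repPoly.eq_def (TwoBridge.orsSeq _ _ _ _), map_mul]
      exact Dvd.dvd.mul_left this _
  · have hseq := (TwoBridge.cong_bottom_orsSeq hB hz ε c n).2
    rcases h.elim (fun hk => hk.orientation_eq_or horient hoK) id with rfl | rfl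
    · exact hseq
    · exact TwoBridge.EqUpToSign.forall₂_trans (TwoBridge.uSeq_reverse _ oA φ) hseq
  · rintro rfl
    exact TwoBridge.take_uSeq_orsSeq a oK ε hε c n
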